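/- Let $n\ge 0$ and let $\mathfrak g$ be the real vector space of multivector fields of degrees $1,\dots,n$ on $\mathbb R^n$ with polynomial coefficients, spanned by the generators $x^{\beta}\partial_{\alpha}=x_1^{b_1}\cdots x_n^{b_n}\,\partial_{a_1}\wedge\cdots\wedge\partial_{a_m}$ with $m=|\alpha|\ge 1$ and $|\beta|=b_1+\cdots+b_n\ge 0$. With the Schouten bracket $[\cdot,\cdot]$, normalised by $$[X_1\wedge\cdots\wedge X_a,\,Y_1\wedge\cdots\wedge Y_b]=\sum_{i,j}(-1)^{i+j}[X_i,Y_j]\wedge X_1\wedge\cdots\widehat{X_i}\cdots\wedge X_a\wedge Y_1\wedge\cdots\widehat{Y_j}\cdots\wedge Y_b$$ for polynomial vector fields $X_i,Y_j$, and the grading in which $\mathfrak g_i$ is the space of $(i+1)$-vector fields, $\mathfrak g$ is a $\mathbb Z$-graded (pre) Lie superalgebra. For $i\ge 0$, $j\ge -1$ let $\mathfrak g_{i,j}\subset\mathfrak g_i$ be the space of $(i+1)$-vector fields whose coefficients are homogeneous polynomials of degree $j+1$, so that $x^\beta\partial_\alpha$ has double weight $(|\alpha|-1,|\beta|-1)$.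 Let $C_m$ be the degree $m$ part of the quotient of the tensor algebra of $\mathfrak g$ by the two-sided ideal generated by all $X\otimes Y+(-1)^{xy}\,Y\otimes X$ with $X\in\mathfrak g_x$, $Y\in\mathfrak g_y$; write $\triangle$ for its product. Let $\partial:C_m\to C_{m-1}$ be the boundary operator determined by $\partial 1=0$ and $$\partial(A_0\,\triangle\, u)=-A_0\,\triangle\,\partial u+A_0\cdot u,\qquad A_0\cdot(A_1\,\triangle\, v)=[A_0,A_1]\,\triangle\, v+(-1)^{a_0a_1}A_1\,\triangle\,(A_0\cdot v),\qquad A_0\cdot 1=0,$$ for homogeneous $A_s\in\mathfrak g_{a_s}$. For integers $w,h$ let $C_m^{w,h}\subset C_m$ be the span of the products $X_1\,\triangle\cdots\triangle\,X_m$ with $X_s\in\mathfrak g_{i_s,h_s}$, $\sum_s i_s=w$, $\sum_s h_s=h$. Then $(C_\bullet^{w,h},\partial)$ is a chain complex. **Theorem.** For every $n$ and every integer $w$ the second Betti number of $(C_\bullet^{w,w},\partial)$ is zero: $\dim H_2(C_\bullet^{w,w})=0$, i.e. every 2-cycle of double weight $(w,w)$ is the boundary of a 3-chain of double weight $(w,w)$.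 -/

import Mathlib

noncomputable section

open scoped TensorProduct

namespace Multivector

/-- Multivector fields on `ℝⁿ` with polynomial coefficients (functions included):
`f ⊗ (e_{a₁} ∧ ⋯ ∧ e_{aₘ})` stands for `f ∂_{a₁} ∧ ⋯ ∧ ∂_{aₘ}`. -/
def MV (n : ℕ) : Type :=
  MvPolynomial (Fin n) ℝ ⊗[ℝ] ExteriorAlgebra ℝ (Fin n → ℝ)

instance instRingMV (n : ℕ) : Ring (MV n) :=
  inferInstanceAs (Ring (MvPolynomial (Fin n) ℝ ⊗[ℝ] ExteriorAlgebra ℝ (Fin n → ℝ)))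

instance instAlgebraMV (n : ℕ) : Algebra ℝ (MV n) :=
  inferInstanceAs (Algebra ℝ (MvPolynomial (Fin n) ℝ ⊗[ℝ] ExteriorAlgebra ℝ (Fin n → ℝ)))

variable {n : ℕ}

/-- The multivector field with coefficient `f` and constant multivector `S`. -/
def mk (n : ℕ) :
    MvPolynomial (Fin n) ℝ →ₗ[ℝ] ExteriorAlgebra ℝ (Fin n → ℝ) →ₗ[ℝ] MV n :=
  TensorProduct.mk ℝ (MvPolynomial (Fin n) ℝ) (ExteriorAlgebra ℝ (Fin n → ℝ))

/-- Partial derivative `∂/∂x_k` of the coefficients. -/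
def diffX (k : Fin n) : MV n →ₗ[ℝ] MV n :=
  LinearMap.rTensor (ExteriorAlgebra ℝ (Fin n → ℝ))
    (MvPolynomial.pderiv (R := ℝ) k).toLinearMap

/-- Contraction with `dx_k` from the left. -/
def contrL (k : Fin n) : MV n →ₗ[ℝ] MV n :=
  LinearMap.lTensor (MvPolynomial (Fin n) ℝ)
    (CliffordAlgebra.contractLeft (Q := (0 : QuadraticForm ℝ (Fin n → ℝ))) (LinearMap.proj k))

/-- Contraction with `dx_k` from the right. -/
def contrR (k : Fin n) : MV n →ₗ[ℝ] MV n :=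
  LinearMap.lTensor (MvPolynomial (Fin n) ℝ)
    (CliffordAlgebra.contractRight (Q := (0 : QuadraticForm ℝ (Fin n → ℝ))).flip
      (LinearMap.proj k))

/-- The Schouten bracket
`[A, B] = ∑ₖ (A ⌊ dxₖ) ∧ ∂B/∂xₖ - ∂A/∂xₖ ∧ (dxₖ ⌋ B)`.
On decomposable multivector fields this is
`[X₁ ∧ ⋯ ∧ X_a, Y₁ ∧ ⋯ ∧ Y_b] = ∑ (-1)^{i+j} [X_i, Y_j] ∧ X₁ ∧ ⋯ X̂_i ⋯ ∧ X_a ∧ Y₁ ∧ ⋯ Ŷ_j ⋯ ∧ Y_b`,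
where `[X_i, Y_j]` is the Lie bracket of vector fields. -/
def schouten (n : ℕ) : MV n →ₗ[ℝ] MV n →ₗ[ℝ] MV n :=
  ∑ k : Fin n, ((LinearMap.mul ℝ (MV n)).compl₁₂ (contrR k) (diffX k)
    - (LinearMap.mul ℝ (MV n)).compl₁₂ (diffX k) (contrL k))

/-- `m`-vector fields. -/
def mvDeg (n m : ℕ) : Submodule ℝ (MV n) :=
  Submodule.map₂ (mk n) ⊤ (⋀[ℝ]^m (Fin n → ℝ))

/-- `m`-vector fields whose coefficients are homogeneous polynomials of degree `q`. -/
def mvBideg (n m q : ℕ) : Submodule ℝ (MV n) :=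
  Submodule.map₂ (mk n) (MvPolynomial.homogeneousSubmodule (Fin n) ℝ q) (⋀[ℝ]^m (Fin n → ℝ))

/-- The degree involution: multiplication by `(-1)^m` on `m`-vector fields. -/
def invol (n : ℕ) : MV n →ₐ[ℝ] MV n :=
  Algebra.TensorProduct.map (AlgHom.id ℝ (MvPolynomial (Fin n) ℝ))
    (CliffordAlgebra.involute (Q := (0 : QuadraticForm ℝ (Fin n → ℝ))))

theorem schouten_apply (X Y : MV n) :
    schouten n X Y = ∑ k : Fin n, (contrR k X * diffX k Y - diffX k X * contrL k Y) := by
  simp [schouten, LinearMap.sum_apply]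

theorem ι_mul_comm (v : Fin n → ℝ) (T : ExteriorAlgebra ℝ (Fin n → ℝ)) :
    ExteriorAlgebra.ι ℝ v * T = CliffordAlgebra.involute T * ExteriorAlgebra.ι ℝ v := by
  induction T using ExteriorAlgebra.induction with
  | algebraMap r => simp [Algebra.commutes]
  | ι x =>
    have := ExteriorAlgebra.ι_add_mul_swap (R := ℝ) v x
    rw [CliffordAlgebra.involute_ι, neg_mul]
    exact eq_neg_of_add_eq_zero_left this
  | mul a b ha hb => rw [← mul_assoc, ha, mul_assoc, hb, ← mul_assoc, map_mul]
  | add a b ha hb => rw [mul_add, ha, hb, map_add, add_mul]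

theorem contractLeft_mul (d : Module.Dual ℝ (Fin n → ℝ))
    (S T : ExteriorAlgebra ℝ (Fin n → ℝ)) :
    CliffordAlgebra.contractLeft d (S * T) = CliffordAlgebra.contractLeft d S * T
      + CliffordAlgebra.involute S * CliffordAlgebra.contractLeft d T := by
  induction S using ExteriorAlgebra.induction generalizing T with
  | algebraMap r => simp [← Algebra.smul_def]
  | ι x => simp [CliffordAlgebra.contractLeft_ι_mul, ← Algebra.smul_def, sub_eq_add_neg]
  | mul a b ha hb => rw [mul_assoc, ha, hb, ha, map_mul]; noncomm_ring
  | add a b ha hb => simp only [add_mul, map_add, ha, hb]; abel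

theorem involute_contractLeft (d : Module.Dual ℝ (Fin n → ℝ))
    (S : ExteriorAlgebra ℝ (Fin n → ℝ)) :
    CliffordAlgebra.involute (CliffordAlgebra.contractLeft d S) =
      - CliffordAlgebra.contractLeft d (CliffordAlgebra.involute S) := by
  induction S using ExteriorAlgebra.induction with
  | algebraMap r => simp
  | ι x => simp
  | mul a b ha hb => simp only [contractLeft_mul, map_mul, map_add, ha, hb]; noncomm_ring
  | add a b ha hb => simp only [map_add, ha, hb]; abel

theorem contractRight_eq_involute (d : Module.Dual ℝ (Fin n → ℝ))
    (S : ExteriorAlgebra ℝ (Fin n → ℝ)) :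
    CliffordAlgebra.contractRight S d =
      CliffordAlgebra.involute (CliffordAlgebra.contractLeft d S) := by
  induction S using CliffordAlgebra.right_induction with
  | algebraMap r => simp
  | add a b ha hb => simp only [map_add, LinearMap.add_apply, ha, hb]
  | mul_ι a b hb =>
    rw [CliffordAlgebra.contractRight_mul_ι, hb]
    have h := contractLeft_mul d b (ExteriorAlgebra.ι ℝ a)
    rw [h]
    simp [Algebra.smul_def, Algebra.commutes]
    abel

theorem involute_of_mem {p : ℕ} {S : ExteriorAlgebra ℝ (Fin n → ℝ)}
    (hS : S ∈ ⋀[ℝ]^p (Fin n → ℝ)) :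
    CliffordAlgebra.involute S = (-1 : ℝ) ^ p • S := by
  induction hS using Submodule.pow_induction_on_left' with
  | algebraMap r => simp
  | add x y i hx hy ihx ihy => rw [map_add, ihx, ihy, smul_add]
  | mem_mul m hm i x hx ih =>
    obtain ⟨v, rfl⟩ := hm
    rw [map_mul, ih, CliffordAlgebra.involute_ι, pow_succ]
    simp

theorem mul_comm_of_mem {p : ℕ} {S : ExteriorAlgebra ℝ (Fin n → ℝ)}
    (hS : S ∈ ⋀[ℝ]^p (Fin n → ℝ)) {q : ℕ} {T : ExteriorAlgebra ℝ (Fin n → ℝ)}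
    (hT : T ∈ ⋀[ℝ]^q (Fin n → ℝ)) : S * T = (-1 : ℝ) ^ (p * q) • (T * S) := by
  induction hS using Submodule.pow_induction_on_left' with
  | algebraMap r => simp [Algebra.commutes]
  | add x y i hx hy ihx ihy => rw [add_mul, ihx, ihy, mul_add, smul_add]
  | mem_mul m hm i x hx ih =>
    obtain ⟨v, rfl⟩ := hm
    rw [mul_assoc, ih, mul_smul_comm, ← mul_assoc, ι_mul_comm, involute_of_mem hT, smul_mul_assoc,
      smul_mul_assoc, smul_smul, ← pow_add, mul_assoc]
    congr 2
    rw [Nat.succ_eq_add_one]; ring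

theorem contractLeft_mem (d : Module.Dual ℝ (Fin n → ℝ)) {p : ℕ}
    {S : ExteriorAlgebra ℝ (Fin n → ℝ)} (hS : S ∈ ⋀[ℝ]^(p + 1) (Fin n → ℝ)) :
    CliffordAlgebra.contractLeft d S ∈ ⋀[ℝ]^p (Fin n → ℝ) := by
  induction p generalizing S with
  | zero =>
    simp only [zero_add, ExteriorAlgebra.exteriorPower, pow_one] at hS
    obtain ⟨v, rfl⟩ := hS
    simp [ExteriorAlgebra.exteriorPower]
  | succ p ih =>
    rw [ExteriorAlgebra.exteriorPower, pow_succ'] at hS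
    induction hS using Submodule.mul_induction_on' with
    | mem_mul_mem m hm x hx =>
      obtain ⟨v, rfl⟩ := hm
      rw [CliffordAlgebra.contractLeft_ι_mul]
      refine sub_mem (Submodule.smul_mem _ _ hx) ?_
      rw [ExteriorAlgebra.exteriorPower, pow_succ']
      exact Submodule.mul_mem_mul (LinearMap.mem_range_self _ _) (ih hx)
    | add x hx y hy ihx ihy => rw [map_add]; exact add_mem ihx ihy

theorem mv_induction {P : MV n → Prop} (h0 : P 0) (ht : ∀ f S, P (mk n f S))
    (ha : ∀ X Y, P X → P Y → P (X + Y)) (X : MV n) : P X :=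
  TensorProduct.induction_on (motive := P) X h0 ht ha

@[simp] theorem diffX_mk (k : Fin n) (f : MvPolynomial (Fin n) ℝ)
    (S : ExteriorAlgebra ℝ (Fin n → ℝ)) :
    diffX k (mk n f S) = mk n (MvPolynomial.pderiv k f) S := rfl

@[simp] theorem contrL_mk (k : Fin n) (f : MvPolynomial (Fin n) ℝ)
    (S : ExteriorAlgebra ℝ (Fin n → ℝ)) :
    contrL k (mk n f S) = mk n f (CliffordAlgebra.contractLeft (LinearMap.proj k) S) := rfl

@[simp] theorem contrR_mk (k : Fin n) (f : MvPolynomial (Fin n) ℝ)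
    (S : ExteriorAlgebra ℝ (Fin n → ℝ)) :
    contrR k (mk n f S) = mk n f (CliffordAlgebra.contractRight S (LinearMap.proj k)) := rfl

@[simp] theorem invol_mk (f : MvPolynomial (Fin n) ℝ)
    (S : ExteriorAlgebra ℝ (Fin n → ℝ)) :
    invol n (mk n f S) = mk n f (CliffordAlgebra.involute S) := rfl

@[simp] theorem mk_mul_mk (f g : MvPolynomial (Fin n) ℝ)
    (S T : ExteriorAlgebra ℝ (Fin n → ℝ)) :
    mk n f S * mk n g T = mk n (f * g) (S * T) :=
  Algebra.TensorProduct.tmul_mul_tmul f g S T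

theorem contrR_eq (k : Fin n) (X : MV n) : contrR k X = invol n (contrL k X) := by
  induction X using mv_induction with
  | h0 => simp
  | ht f S => simp [contractRight_eq_involute]
  | ha X Y hX hY => simp only [map_add, hX, hY]

theorem diffX_mul (k : Fin n) (X Y : MV n) :
    diffX k (X * Y) = diffX k X * Y + X * diffX k Y := by
  induction X using mv_induction with
  | h0 => simp
  | ht f S =>
    induction Y using mv_induction with
    | h0 => simp
    | ht g T => simp [Derivation.leibniz, add_comm, mul_comm]
    | ha X Y hX hY => simp only [mul_add, map_add, hX, hY]; abel
  | ha X Y hX hY => simp only [add_mul, map_add, hX, hY]; abel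

theorem contrL_mul (k : Fin n) (X Y : MV n) :
    contrL k (X * Y) = contrL k X * Y + invol n X * contrL k Y := by
  induction X using mv_induction with
  | h0 => simp
  | ht f S =>
    induction Y using mv_induction with
    | h0 => simp
    | ht g T => simp [contractLeft_mul]
    | ha X Y hX hY => simp only [mul_add, map_add, hX, hY]; abel
  | ha X Y hX hY => simp only [add_mul, map_add, hX, hY]; abel

theorem diffX_comm (k l : Fin n) (X : MV n) : diffX k (diffX l X) = diffX l (diffX k X) := by
  induction X using mv_induction with
  | h0 => simp
  | ht f S =>
    have : MvPolynomial.pderiv k (MvPolynomial.pderiv l f)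
        = MvPolynomial.pderiv l (MvPolynomial.pderiv k f) := by
      have h : ⁅MvPolynomial.pderiv (R := ℝ) k, MvPolynomial.pderiv (R := ℝ) l⁆ = 0 := by
        apply MvPolynomial.derivation_ext
        intro i
        rw [Derivation.commutator_apply]
        simp [MvPolynomial.pderiv_X, Pi.single_apply, apply_ite]
      have := congrArg (fun D => D f) h
      rw [Derivation.commutator_apply] at this
      exact sub_eq_zero.mp this
    simp [this]
  | ha X Y hX hY => simp only [map_add, hX, hY]

theorem contrL_anticomm (k l : Fin n) (X : MV n) :
    contrL k (contrL l X) = - contrL l (contrL k X) := by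
  induction X using mv_induction with
  | h0 => simp
  | ht f S => simp only [contrL_mk]; rw [CliffordAlgebra.contractLeft_comm, map_neg]
  | ha X Y hX hY => simp only [map_add, hX, hY]; abel

theorem contrL_diffX (k l : Fin n) (X : MV n) :
    contrL k (diffX l X) = diffX l (contrL k X) := by
  induction X using mv_induction with
  | h0 => simp
  | ht f S => simp
  | ha X Y hX hY => simp only [map_add, hX, hY]

theorem invol_diffX (l : Fin n) (X : MV n) :
    invol n (diffX l X) = diffX l (invol n X) := by
  induction X using mv_induction with
  | h0 => simp
  | ht f S => simp
  | ha X Y hX hY => simp only [map_add, hX, hY]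

theorem invol_contrL (l : Fin n) (X : MV n) :
    invol n (contrL l X) = - contrL l (invol n X) := by
  induction X using mv_induction with
  | h0 => simp
  | ht f S => simp [involute_contractLeft]
  | ha X Y hX hY => simp only [map_add, hX, hY]; abel

theorem invol_invol (X : MV n) : invol n (invol n X) = X := by
  induction X using mv_induction with
  | h0 => simp
  | ht f S => simp
  | ha X Y hX hY => simp only [map_add, hX, hY]

theorem mvBideg_le (n m q : ℕ) : mvBideg n m q ≤ mvDeg n m :=
  Submodule.map₂_le_map₂ le_top le_rfl

theorem mul_mem_mvDeg {p q : ℕ} {X Y : MV n} (hX : X ∈ mvDeg n p) (hY : Y ∈ mvDeg n q) :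
    X * Y ∈ mvDeg n (p + q) := by
  have : mvDeg n p ≤ (mvDeg n (p + q)).comap (LinearMap.mulRight ℝ Y) := by
    refine Submodule.map₂_le.2 fun f _ S hS => ?_
    have : mvDeg n q ≤ (mvDeg n (p + q)).comap (LinearMap.mulLeft ℝ (mk n f S)) := by
      refine Submodule.map₂_le.2 fun g _ T hT => ?_
      rw [Submodule.mem_comap, LinearMap.mulLeft_apply, mk_mul_mk]
      refine Submodule.apply_mem_map₂ _ trivial ?_
      rw [ExteriorAlgebra.exteriorPower, pow_add]
      exact Submodule.mul_mem_mul hS hT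
    exact this hY
  exact this hX

theorem mul_mem_mvBideg {p q i j : ℕ} {X Y : MV n} (hX : X ∈ mvBideg n p i)
    (hY : Y ∈ mvBideg n q j) : X * Y ∈ mvBideg n (p + q) (i + j) := by
  have : mvBideg n p i ≤ (mvBideg n (p + q) (i + j)).comap (LinearMap.mulRight ℝ Y) := by
    refine Submodule.map₂_le.2 fun f hf S hS => ?_
    have : mvBideg n q j ≤
        (mvBideg n (p + q) (i + j)).comap (LinearMap.mulLeft ℝ (mk n f S)) := by
      refine Submodule.map₂_le.2 fun g hg T hT => ?_
      rw [Submodule.mem_comap, LinearMap.mulLeft_apply, mk_mul_mk]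
      refine Submodule.apply_mem_map₂ _ (MvPolynomial.IsHomogeneous.mul hf hg) ?_
      rw [ExteriorAlgebra.exteriorPower, pow_add]
      exact Submodule.mul_mem_mul hS hT
    exact this hY
  exact this hX

theorem diffX_mem_mvDeg {p : ℕ} {X : MV n} (k : Fin n) (hX : X ∈ mvDeg n p) :
    diffX k X ∈ mvDeg n p := by
  have : mvDeg n p ≤ (mvDeg n p).comap (diffX k) :=
    Submodule.map₂_le.2 fun f _ S hS => Submodule.apply_mem_map₂ _ trivial hS
  exact this hX

theorem contrL_mem_mvDeg {p : ℕ} {X : MV n} (k : Fin n) (hX : X ∈ mvDeg n (p + 1)) :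
    contrL k X ∈ mvDeg n p := by
  have : mvDeg n (p + 1) ≤ (mvDeg n p).comap (contrL k) :=
    Submodule.map₂_le.2 fun f _ S hS =>
      Submodule.apply_mem_map₂ _ trivial (contractLeft_mem _ hS)
  exact this hX

theorem invol_of_mem {p : ℕ} {X : MV n} (hX : X ∈ mvDeg n p) :
    invol n X = (-1 : ℝ) ^ p • X := by
  have : mvDeg n p ≤ LinearMap.eqLocus (invol n).toLinearMap ((-1 : ℝ) ^ p • LinearMap.id) :=
    Submodule.map₂_le.2 fun f _ S hS => by
      simp [LinearMap.mem_eqLocus, involute_of_mem hS]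
  exact this hX

theorem mul_comm_of_mem_mvDeg {p q : ℕ} {X Y : MV n} (hX : X ∈ mvDeg n p)
    (hY : Y ∈ mvDeg n q) : X * Y = (-1 : ℝ) ^ (p * q) • (Y * X) := by
  have : mvDeg n p ≤ LinearMap.eqLocus (LinearMap.mulRight ℝ Y)
      ((-1 : ℝ) ^ (p * q) • LinearMap.mulLeft ℝ Y) := by
    refine Submodule.map₂_le.2 fun f _ S hS => ?_
    have : mvDeg n q ≤ LinearMap.eqLocus (LinearMap.mulLeft ℝ (mk n f S))
      ((-1 : ℝ) ^ (p * q) • LinearMap.mulRight ℝ (mk n f S)) := by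
      refine Submodule.map₂_le.2 fun g _ T hT => ?_
      simp [LinearMap.mem_eqLocus, mul_comm_of_mem hS hT, mul_comm f g]
    exact this hY
  exact this hX

theorem contrL_contrL_mul_comm {x q : ℕ} {X W : MV n} (k l : Fin n) (hX : X ∈ mvDeg n (x + 1))
    (hW : W ∈ mvDeg n q) :
    W * contrL k (contrL l X) = (-1 : ℝ) ^ ((x + 1) * q) • (contrL k (contrL l X) * W) := by
  rcases x with _ | x
  · have h : contrL k (contrL l X) = 0 := by
      have : mvDeg n (0 + 1) ≤ LinearMap.ker (contrL k ∘ₗ contrL l) := by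
        refine Submodule.map₂_le.2 fun f _ S hS => ?_
        simp only [zero_add, ExteriorAlgebra.exteriorPower, pow_one] at hS
        obtain ⟨v, rfl⟩ := hS
        simp
      exact this hX
    simp [h]
  · rw [mul_comm_of_mem_mvDeg hW (contrL_mem_mvDeg k (contrL_mem_mvDeg l hX))]
    congr 1
    have : (x + 1 + 1) * q = q * x + 2 * q := by ring
    rw [this, pow_add, pow_mul _ 2]
    simp

/-- Super skew-symmetry of the Schouten bracket. -/
theorem schouten_skew {x y : ℕ} {X Y : MV n} (hX : X ∈ mvDeg n (x + 1))
    (hY : Y ∈ mvDeg n (y + 1)) :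
    schouten n X Y = -((-1 : ℝ) ^ (x * y) • schouten n Y X) := by
  simp only [schouten_apply, contrR_eq]
  rw [Finset.smul_sum, ← Finset.sum_neg_distrib]
  refine Finset.sum_congr rfl fun k _ => ?_
  rw [invol_of_mem (contrL_mem_mvDeg k hX), invol_of_mem (contrL_mem_mvDeg k hY),
    smul_mul_assoc, smul_mul_assoc,
    mul_comm_of_mem_mvDeg (contrL_mem_mvDeg k hX) (diffX_mem_mvDeg k hY),
    mul_comm_of_mem_mvDeg (contrL_mem_mvDeg k hY) (diffX_mem_mvDeg k hX)]
  have e1 : x + x * (y + 1) = x * y + 2 * x := by ring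
  have e2 : x * y + y + y * (x + 1) = 2 * (x * y + y) := by ring
  rw [smul_sub, smul_smul, smul_smul, smul_smul, ← pow_add, ← pow_add, ← pow_add, e1, e2, pow_add,
    pow_mul _ 2, pow_mul _ 2]
  simp

theorem jacobi_pointwise {x y : ℕ} {X Y : MV n} (hX : X ∈ mvDeg n (x + 1))
    (hY : Y ∈ mvDeg n (y + 1)) (Z : MV n) (k l : Fin n) :
    invol n (contrL k X) * diffX k (invol n (contrL l Y) * diffX l Z - diffX l Y * contrL l Z)
      - diffX k X * contrL k (invol n (contrL l Y) * diffX l Z - diffX l Y * contrL l Z)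
    + (invol n (contrL l X) * diffX l (invol n (contrL k Y) * diffX k Z - diffX k Y * contrL k Z)
      - diffX l X * contrL l (invol n (contrL k Y) * diffX k Z - diffX k Y * contrL k Z)) =
    invol n (contrL l (invol n (contrL k X) * diffX k Y - diffX k X * contrL k Y)) * diffX l Z
      - diffX l (invol n (contrL k X) * diffX k Y - diffX k X * contrL k Y) * contrL l Z
    + (invol n (contrL k (invol n (contrL l X) * diffX l Y - diffX l X * contrL l Y)) * diffX k Z
      - diffX k (invol n (contrL l X) * diffX l Y - diffX l X * contrL l Y) * contrL k Z)
    + (-1 : ℝ) ^ (x * y) •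
     (invol n (contrL k Y) * diffX k (invol n (contrL l X) * diffX l Z - diffX l X * contrL l Z)
      - diffX k Y * contrL k (invol n (contrL l X) * diffX l Z - diffX l X * contrL l Z)
    + (invol n (contrL l Y) * diffX l (invol n (contrL k X) * diffX k Z - diffX k X * contrL k Z)
      - diffX l Y * contrL l (invol n (contrL k X) * diffX k Z - diffX k X * contrL k Z))) := by
  have sX := invol_of_mem hX
  have sY := invol_of_mem hY
  have c1 : ∀ i j, contrL i Y * contrL j X = _ := fun i j =>
    mul_comm_of_mem_mvDeg (contrL_mem_mvDeg i hY) (contrL_mem_mvDeg j hX)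
  have c2 : ∀ i j, contrL i Y * diffX j X = _ := fun i j =>
    mul_comm_of_mem_mvDeg (contrL_mem_mvDeg i hY) (diffX_mem_mvDeg j hX)
  have c3 : ∀ i j h, contrL i Y * diffX h (contrL j X) = _ := fun i j h =>
    mul_comm_of_mem_mvDeg (contrL_mem_mvDeg i hY) (diffX_mem_mvDeg h (contrL_mem_mvDeg j hX))
  have c4 : ∀ i j h, contrL i Y * diffX h (diffX j X) = _ := fun i j h =>
    mul_comm_of_mem_mvDeg (contrL_mem_mvDeg i hY) (diffX_mem_mvDeg h (diffX_mem_mvDeg j hX))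
  have d1 : ∀ i j, diffX i Y * contrL j X = _ := fun i j =>
    mul_comm_of_mem_mvDeg (diffX_mem_mvDeg i hY) (contrL_mem_mvDeg j hX)
  have d2 : ∀ i j, diffX i Y * diffX j X = _ := fun i j =>
    mul_comm_of_mem_mvDeg (diffX_mem_mvDeg i hY) (diffX_mem_mvDeg j hX)
  have d3 : ∀ i j h, diffX i Y * diffX h (contrL j X) = _ := fun i j h =>
    mul_comm_of_mem_mvDeg (diffX_mem_mvDeg i hY) (diffX_mem_mvDeg h (contrL_mem_mvDeg j hX))
  have d4 : ∀ i j h, diffX i Y * contrL h (contrL j X) = _ := fun i j h =>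
    contrL_contrL_mul_comm h j hX (diffX_mem_mvDeg i hY)
  have a1 := contrL_anticomm l k X
  have a2 := contrL_anticomm l k Y
  have a3 := contrL_anticomm l k Z
  have b1 := diffX_comm l k X
  have b2 := diffX_comm l k Y
  have b3 := diffX_comm l k Z
  simp only [map_sub, map_mul, map_add, diffX_mul, contrL_mul, invol_contrL, invol_diffX,
    invol_invol, contrL_diffX, map_neg]
  rcases Nat.even_or_odd x with hx | hx <;> rcases Nat.even_or_odd y with hy | hy <;>
  · simp only [pow_mul, pow_succ, hx.neg_one_pow, hy.neg_one_pow, one_pow, mul_neg,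
      mul_one, neg_neg, neg_smul, one_smul, neg_mul] at *
    simp only [sX, sY, a1, a2, a3, b1, b2, b3, map_neg, mul_sub, mul_add, sub_mul,
      add_mul, ← mul_assoc,
      neg_neg, mul_neg, neg_mul]
    simp only [c1, c2, c3, c4, d1, d2, d3, d4, neg_mul, neg_neg]
    abel

/-- The super Jacobi identity for the Schouten bracket, in Leibniz form. -/
theorem schouten_jacobi {x y : ℕ} {X Y : MV n} (hX : X ∈ mvDeg n (x + 1))
    (hY : Y ∈ mvDeg n (y + 1)) (Z : MV n) :
    schouten n X (schouten n Y Z) =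
      schouten n (schouten n X Y) Z + (-1 : ℝ) ^ (x * y) • schouten n Y (schouten n X Z) := by
  have key := Finset.sum_congr (rfl : (Finset.univ : Finset (Fin n)) = Finset.univ) fun k _ =>
    Finset.sum_congr (rfl : (Finset.univ : Finset (Fin n)) = Finset.univ) fun l _ =>
      jacobi_pointwise hX hY Z k l
  simp only [Finset.sum_add_distrib, ← Finset.smul_sum] at key
  have e1 : schouten n X (schouten n Y Z) = ∑ k, ∑ l,
      (invol n (contrL k X) * diffX k (invol n (contrL l Y) * diffX l Z - diffX l Y * contrL l Z)
      - diffX k X * contrL k (invol n (contrL l Y) * diffX l Z - diffX l Y * contrL l Z)) := by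
    simp only [schouten_apply, contrR_eq]
    refine Finset.sum_congr rfl fun k _ => ?_
    rw [map_sum, map_sum, Finset.mul_sum, Finset.mul_sum, ← Finset.sum_sub_distrib]
  have e2 : schouten n Y (schouten n X Z) = ∑ k, ∑ l,
      (invol n (contrL k Y) * diffX k (invol n (contrL l X) * diffX l Z - diffX l X * contrL l Z)
      - diffX k Y * contrL k (invol n (contrL l X) * diffX l Z - diffX l X * contrL l Z)) := by
    simp only [schouten_apply, contrR_eq]
    refine Finset.sum_congr rfl fun k _ => ?_
    rw [map_sum, map_sum, Finset.mul_sum, Finset.mul_sum, ← Finset.sum_sub_distrib]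
  have e3 : schouten n (schouten n X Y) Z = ∑ l, ∑ k,
      (invol n (contrL l (invol n (contrL k X) * diffX k Y - diffX k X * contrL k Y)) * diffX l Z
      - diffX l (invol n (contrL k X) * diffX k Y - diffX k X * contrL k Y) * contrL l Z) := by
    simp only [schouten_apply, contrR_eq]
    refine Finset.sum_congr rfl fun k _ => ?_
    rw [map_sum, map_sum, map_sum, Finset.sum_mul, Finset.sum_mul, ← Finset.sum_sub_distrib]
  have e1' := e1.trans Finset.sum_comm
  have e2' := e2.trans Finset.sum_comm
  have e3' := e3.trans Finset.sum_comm
  rw [← e1, ← e1', ← e2, ← e2', ← e3, ← e3'] at key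
  have h2 : (2 : ℝ) • schouten n X (schouten n Y Z) = (2 : ℝ) • (schouten n (schouten n X Y) Z
      + (-1 : ℝ) ^ (x * y) • schouten n Y (schouten n X Z)) := by
    rw [two_smul, two_smul, key, smul_add]; abel
  exact smul_right_injective _ two_ne_zero h2

theorem schouten_mem_mvDeg {x y : ℕ} {X Y : MV n} (hX : X ∈ mvDeg n (x + 1))
    (hY : Y ∈ mvDeg n (y + 1)) : schouten n X Y ∈ mvDeg n (x + y + 1) := by
  rw [schouten_apply]
  refine sum_mem fun k _ => sub_mem ?_ ?_
  · rw [contrR_eq, invol_of_mem (contrL_mem_mvDeg k hX), smul_mul_assoc]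
    have := mul_mem_mvDeg (contrL_mem_mvDeg k hX) (diffX_mem_mvDeg k hY)
    exact Submodule.smul_mem _ _ this
  · have := mul_mem_mvDeg (diffX_mem_mvDeg k hX) (contrL_mem_mvDeg k hY)
    rwa [show x + 1 + y = x + y + 1 by ring] at this

theorem diffX_mem_mvBideg {p q : ℕ} {X : MV n} (k : Fin n) (hX : X ∈ mvBideg n p (q + 1)) :
    diffX k X ∈ mvBideg n p q := by
  have : mvBideg n p (q + 1) ≤ (mvBideg n p q).comap (diffX k) :=
    Submodule.map₂_le.2 fun f hf S hS =>
      Submodule.apply_mem_map₂ _ (MvPolynomial.IsHomogeneous.pderiv hf) hS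
  exact this hX

theorem diffX_eq_zero {p : ℕ} {X : MV n} (k : Fin n) (hX : X ∈ mvBideg n p 0) :
    diffX k X = 0 := by
  have : mvBideg n p 0 ≤ LinearMap.ker (diffX k) := by
    refine Submodule.map₂_le.2 fun f hf S hS => ?_
    rw [MvPolynomial.mem_homogeneousSubmodule] at hf
    have hf' := MvPolynomial.totalDegree_eq_zero_iff_eq_C.1 (Nat.le_zero.1 hf.totalDegree_le)
    rw [LinearMap.mem_ker, diffX_mk, hf', MvPolynomial.pderiv_C, map_zero, LinearMap.zero_apply]
  exact this hX

theorem contrL_mem_mvBideg {p q : ℕ} {X : MV n} (k : Fin n) (hX : X ∈ mvBideg n (p + 1) q) :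
    contrL k X ∈ mvBideg n p q := by
  have : mvBideg n (p + 1) q ≤ (mvBideg n p q).comap (contrL k) :=
    Submodule.map₂_le.2 fun f hf S hS =>
      Submodule.apply_mem_map₂ _ hf (contractLeft_mem _ hS)
  exact this hX

theorem schouten_mem_mvBideg {x y i j : ℕ} {X Y : MV n} (hX : X ∈ mvBideg n (x + 1) i)
    (hY : Y ∈ mvBideg n (y + 1) j) :
    schouten n X Y = 0 ∨ ∃ r, i + j = r + 1 ∧ schouten n X Y ∈ mvBideg n (x + y + 1) r := by
  have h1 : ∀ k r, i + j = r + 1 → contrR k X * diffX k Y ∈ mvBideg n (x + y + 1) r := by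
    intro k r hr
    rw [contrR_eq, invol_of_mem (contrL_mem_mvDeg k (mvBideg_le _ _ _ hX)), smul_mul_assoc]
    refine Submodule.smul_mem _ _ ?_
    rcases j with _ | j
    · rw [diffX_eq_zero k hY, mul_zero]; exact zero_mem _
    · have := mul_mem_mvBideg (contrL_mem_mvBideg k hX) (diffX_mem_mvBideg k hY)
      rwa [show i + j = r by omega] at this
  have h2 : ∀ k r, i + j = r + 1 → diffX k X * contrL k Y ∈ mvBideg n (x + y + 1) r := by
    intro k r hr
    rcases i with _ | i
    · rw [diffX_eq_zero k hX, zero_mul]; exact zero_mem _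
    · have := mul_mem_mvBideg (diffX_mem_mvBideg k hX) (contrL_mem_mvBideg k hY)
      rwa [show i + j = r by omega, show x + 1 + y = x + y + 1 by ring] at this
  rcases h : i + j with _ | r
  · left
    obtain ⟨rfl, rfl⟩ : i = 0 ∧ j = 0 := by omega
    rw [schouten_apply]
    exact Finset.sum_eq_zero fun k _ => by simp [diffX_eq_zero k hX, diffX_eq_zero k hY]
  · right
    refine ⟨r, rfl, ?_⟩
    rw [schouten_apply]
    exact sum_mem fun k _ => sub_mem (h1 k r h) (h2 k r h)

/-- Sums of `m`-vector fields with `m ≥ 1`. -/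
def posDeg (n : ℕ) : Submodule ℝ (MV n) := ⨆ i : ℕ, mvDeg n (i + 1)

/-- The pre Lie superalgebra `⨁_{m=1}^{n} (m-vector fields with polynomial coefficients)`. -/
abbrev PolyMV (n : ℕ) : Type := posDeg n

/-- The homogeneous part of degree `i`: the `(i+1)`-vector fields. -/
def grade (n i : ℕ) : Submodule ℝ (PolyMV n) := (mvDeg n (i + 1)).comap (posDeg n).subtype

/-- The part of double weight `(i, q - 1)`: the `(i+1)`-vector fields whose coefficients are
homogeneous polynomials of degree `q`. -/
def bigrade (n i q : ℕ) : Submodule ℝ (PolyMV n) :=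
  (mvBideg n (i + 1) q).comap (posDeg n).subtype

theorem bigrade_le (n i q : ℕ) : bigrade n i q ≤ grade n i := fun _ h => mvBideg_le _ _ _ h

theorem mvDeg_le_posDeg (n i : ℕ) : mvDeg n (i + 1) ≤ posDeg n :=
  le_iSup (fun i => mvDeg n (i + 1)) i

theorem posDeg_le {N : Submodule ℝ (MV n)} (h : ∀ i, mvDeg n (i + 1) ≤ N) : posDeg n ≤ N :=
  iSup_le h

theorem schouten_mem_posDeg {X Y : MV n} (hX : X ∈ posDeg n) (hY : Y ∈ posDeg n) :
    schouten n X Y ∈ posDeg n := by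
  have : posDeg n ≤ (posDeg n).comap ((schouten n).flip Y) := by
    refine posDeg_le fun i X hX => ?_
    have : posDeg n ≤ (posDeg n).comap (schouten n X) :=
      posDeg_le fun j Y hY => mvDeg_le_posDeg _ _ (schouten_mem_mvDeg hX hY)
    exact this hY
  exact this hX

theorem invol_mem_posDeg {X : MV n} (hX : X ∈ posDeg n) : invol n X ∈ posDeg n := by
  have : posDeg n ≤ (posDeg n).comap (invol n).toLinearMap := by
    refine posDeg_le fun i X hX => ?_
    rw [Submodule.mem_comap, AlgHom.toLinearMap_apply, invol_of_mem hX]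
    exact Submodule.smul_mem _ _ (mvDeg_le_posDeg _ _ hX)
  exact this hX

/-- The Schouten bracket on `PolyMV n`. -/
def bracket (n : ℕ) : PolyMV n →ₗ[ℝ] PolyMV n →ₗ[ℝ] PolyMV n :=
  LinearMap.mk₂ ℝ (fun X Y => ⟨schouten n X Y, schouten_mem_posDeg X.2 Y.2⟩)
    (fun X X' Y => Subtype.ext (by simp)) (fun c X Y => Subtype.ext (by simp))
    (fun X Y Y' => Subtype.ext (by simp)) (fun c X Y => Subtype.ext (by simp))

/-- The parity operator: multiplication by `(-1)^i` on the homogeneous part of degree `i`. -/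
def parity (n : ℕ) : PolyMV n →ₗ[ℝ] PolyMV n :=
  -((invol n).toLinearMap.restrict fun _ h => invol_mem_posDeg h)

theorem parity_of_mem {i : ℕ} {X : PolyMV n} (hX : X ∈ grade n i) :
    parity n X = (-1 : ℝ) ^ i • X := by
  apply Subtype.ext
  change -invol n (X : MV n) = (-1 : ℝ) ^ i • (X : MV n)
  simp [invol_of_mem (show (X : MV n) ∈ mvDeg n (i + 1) from hX), pow_succ]

theorem bracket_mem_grade {a b : ℕ} {A B : PolyMV n} (hA : A ∈ grade n a) (hB : B ∈ grade n b) :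
    bracket n A B ∈ grade n (a + b) := schouten_mem_mvDeg hA hB

theorem bracket_mem_bigrade {a b i j : ℕ} {A B : PolyMV n} (hA : A ∈ bigrade n a i)
    (hB : B ∈ bigrade n b j) :
    bracket n A B = 0 ∨ ∃ r, i + j = r + 1 ∧ bracket n A B ∈ bigrade n (a + b) r :=
  (schouten_mem_mvBideg hA hB).imp (fun h => Subtype.ext h) id

theorem bracket_skew {a b : ℕ} {A B : PolyMV n} (hA : A ∈ grade n a) (hB : B ∈ grade n b) :
    bracket n A B = -((-1 : ℝ) ^ (a * b) • bracket n B A) :=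
  Subtype.ext (schouten_skew hA hB)

theorem bracket_jacobi {a b : ℕ} {A B : PolyMV n} (hA : A ∈ grade n a) (hB : B ∈ grade n b)
    (C : PolyMV n) : bracket n A (bracket n B C) =
      bracket n (bracket n A B) C + (-1 : ℝ) ^ (a * b) • bracket n B (bracket n A C) :=
  Subtype.ext (schouten_jacobi hA hB C)

theorem iSup_grade (n : ℕ) : ⨆ i, grade n i = ⊤ := by
  rw [eq_top_iff]
  rintro ⟨X, hX⟩ -
  have : posDeg n ≤ (⨆ i, grade n i).map (posDeg n).subtype := by
    refine posDeg_le fun i Y hY => ?_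
    exact ⟨⟨Y, mvDeg_le_posDeg _ _ hY⟩, Submodule.mem_iSup_of_mem i hY, rfl⟩
  obtain ⟨Y, hY, rfl⟩ := this hX
  exact hY

theorem grade_ext {M : Type*} [AddCommGroup M] [Module ℝ M] {f g : PolyMV n →ₗ[ℝ] M}
    (h : ∀ i, ∀ X ∈ grade n i, f X = g X) : f = g := by
  have : (⊤ : Submodule ℝ (PolyMV n)) ≤ LinearMap.eqLocus f g := by
    rw [← iSup_grade]; exact iSup_le h
  exact LinearMap.ext fun X => this trivial

/-- The relations `X ⊗ Y + (-1)^{xy} Y ⊗ X = 0` for `X`, `Y` homogeneous of degrees `x`, `y`. -/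
inductive ChainRel (n : ℕ) : TensorAlgebra ℝ (PolyMV n) → TensorAlgebra ℝ (PolyMV n) → Prop
  | swap (x y : ℕ) (X Y : PolyMV n) (hX : X ∈ grade n x) (hY : Y ∈ grade n y) :
    ChainRel n (TensorAlgebra.ι ℝ X * TensorAlgebra.ι ℝ Y
      + (-1 : ℝ) ^ (x * y) • (TensorAlgebra.ι ℝ Y * TensorAlgebra.ι ℝ X)) 0

/-- The algebra of all chains: the tensor algebra modulo the two-sided ideal generated by
`ChainRel`. Its product is the super wedge product. -/
def Chains (n : ℕ) : Type := RingQuot (ChainRel n)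

instance instRingChains (n : ℕ) : Ring (Chains n) := inferInstanceAs (Ring (RingQuot (ChainRel n)))

instance instAlgebraChains (n : ℕ) : Algebra ℝ (Chains n) :=
  inferInstanceAs (Algebra ℝ (RingQuot (ChainRel n)))

/-- The projection from the tensor algebra to the algebra of chains. -/
def toChains (n : ℕ) : TensorAlgebra ℝ (PolyMV n) →ₐ[ℝ] Chains n :=
  RingQuot.mkAlgHom ℝ (ChainRel n)

/-- A multivector field as a 1-chain. -/
def single (n : ℕ) : PolyMV n →ₗ[ℝ] Chains n := (toChains n).toLinearMap ∘ₗ TensorAlgebra.ι ℝ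

theorem single_swap {x y : ℕ} {X Y : PolyMV n} (hX : X ∈ grade n x) (hY : Y ∈ grade n y) :
    single n X * single n Y + (-1 : ℝ) ^ (x * y) • (single n Y * single n X) = 0 := by
  have := RingQuot.mkAlgHom_rel ℝ (ChainRel.swap x y X Y hX hY)
  have h2 : toChains n _ = toChains n _ := this
  simpa [single] using h2

/-- `signSwap B η A = (-1)^{ab} B △ η(A)` for `A`, `B` homogeneous of degrees `a`, `b`,
extended bilinearly. -/
def signSwap (B : PolyMV n) (η : PolyMV n →ₗ[ℝ] Chains n) : PolyMV n →ₗ[ℝ] Chains n :=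
  (1 / 2 : ℝ) • (LinearMap.mulLeft ℝ (single n B) ∘ₗ (η + η ∘ₗ parity n)
    + LinearMap.mulLeft ℝ (single n (parity n B)) ∘ₗ (η - η ∘ₗ parity n))

theorem signSwap_apply {a b : ℕ} {A B : PolyMV n} (hA : A ∈ grade n a) (hB : B ∈ grade n b)
    (η : PolyMV n →ₗ[ℝ] Chains n) :
    signSwap B η A = (-1 : ℝ) ^ (a * b) • (single n B * η A) := by
  simp only [signSwap, LinearMap.smul_apply, LinearMap.add_apply, LinearMap.comp_apply,
    LinearMap.mulLeft_apply, LinearMap.sub_apply, parity_of_mem hA, parity_of_mem hB, map_smul,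
    smul_mul_assoc, mul_add, mul_sub, mul_smul_comm, pow_mul]
  rcases Nat.even_or_odd a with ha | ha <;> rcases Nat.even_or_odd b with hb | hb <;>
  · simp only [ha.neg_one_pow, hb.neg_one_pow, one_pow]
    module

/-- Left multiplication by `B`, recorded on triples `(u, A ↦ A · u, ∂u)`: it sends the triple of `u`
to the triple of `B △ u`, where
`A · (B △ u) = [A, B] △ u + (-1)^{ab} B △ (A · u)` and `∂(B △ u) = -B △ ∂u + B · u`. -/
def step (n : ℕ) :
    PolyMV n →ₗ[ℝ] Module.End ℝ (Chains n × (PolyMV n →ₗ[ℝ] Chains n) × Chains n) :=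
  LinearMap.mk₂ ℝ (fun B t =>
      (single n B * t.1,
        LinearMap.mulRight ℝ t.1 ∘ₗ single n ∘ₗ (bracket n).flip B + signSwap B t.2.1,
        -(single n B * t.2.2) + t.2.1 B))
    (fun B B' t => by
      refine Prod.ext ?_ (Prod.ext (LinearMap.ext fun A => ?_) ?_)
      · simp [add_mul]
      · simp [signSwap, add_mul, mul_add]; module
      · simp [add_mul]; abel)
    (fun c B t => by
      refine Prod.ext ?_ (Prod.ext (LinearMap.ext fun A => ?_) ?_)
      · simp
      · simp [signSwap]; module
      · simp)
    (fun B t t' => by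
      refine Prod.ext ?_ (Prod.ext (LinearMap.ext fun A => ?_) ?_)
      · simp [mul_add]
      · simp [signSwap, mul_add, mul_sub]; module
      · simp [mul_add]; abel)
    (fun c B t => by
      refine Prod.ext ?_ (Prod.ext (LinearMap.ext fun A => ?_) ?_)
      · simp
      · simp [signSwap, mul_add, mul_sub]; module
      · simp)

theorem step_apply (B : PolyMV n) (t : Chains n × (PolyMV n →ₗ[ℝ] Chains n) × Chains n) :
    step n B t = (single n B * t.1,
      LinearMap.mulRight ℝ t.1 ∘ₗ single n ∘ₗ (bracket n).flip B + signSwap B t.2.1,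
      -(single n B * t.2.2) + t.2.1 B) := rfl

theorem step_swap {x y : ℕ} {X Y : PolyMV n} (hX : X ∈ grade n x) (hY : Y ∈ grade n y) :
    step n X * step n Y + (-1 : ℝ) ^ (x * y) • (step n Y * step n X) = 0 := by
  have hss : (-1 : ℝ) ^ (x * y) * (-1 : ℝ) ^ (x * y) = 1 := by
    rw [← pow_add, ← two_mul, pow_mul]; simp
  refine LinearMap.ext fun t => ?_
  obtain ⟨u, η, v⟩ := t
  have hXY := single_swap hX hY
  refine Prod.ext ?_ (Prod.ext (grade_ext fun a A hA => ?_) ?_)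
  · simp only [LinearMap.add_apply, LinearMap.smul_apply, Module.End.mul_apply, step_apply,
      Prod.fst_add, Prod.smul_fst, LinearMap.zero_apply, Prod.fst_zero]
    rw [← mul_assoc, ← mul_assoc, ← smul_mul_assoc, ← add_mul, hXY, zero_mul]
  · have h1 := single_swap (bracket_mem_grade hA hX) hY
    have h2 := single_swap (bracket_mem_grade hA hY) hX
    simp only [LinearMap.add_apply, LinearMap.smul_apply, Module.End.mul_apply, step_apply,
      Prod.snd_add, Prod.smul_snd, Prod.fst_add, Prod.smul_fst, LinearMap.zero_apply, Prod.fst_zero,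
      Prod.snd_zero, LinearMap.comp_apply, LinearMap.mulRight_apply, LinearMap.flip_apply,
      signSwap_apply hA hX, signSwap_apply hA hY]
    have h1' := congrArg (· * u) h1
    have h2' := congrArg (· * u) h2
    have h3' := congrArg (· * η A) hXY
    rw [add_mul a, pow_add, ← mul_comm x y] at h2'
    rw [add_mul a, pow_add] at h1'
    simp only [add_mul, smul_mul_assoc, zero_mul, mul_assoc] at h1' h2' h3'
    simp only [mul_add, smul_add, mul_smul_comm]
    linear_combination (norm := module) h1' + (-1 : ℝ) ^ (x * y) • h2'
      + ((-1 : ℝ) ^ (a * x) * (-1 : ℝ) ^ (a * y)) • h3'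
      - hss • ((-1 : ℝ) ^ (a * x) • (single n X * (single n (bracket n A Y) * u)))
  · simp only [LinearMap.add_apply, LinearMap.smul_apply, Module.End.mul_apply, step_apply,
      Prod.snd_add, Prod.smul_snd, LinearMap.zero_apply, Prod.snd_zero,
      LinearMap.comp_apply, LinearMap.mulRight_apply, LinearMap.flip_apply,
      signSwap_apply hX hY, signSwap_apply hY hX]
    have h3' := congrArg (· * v) hXY
    simp only [add_mul, smul_mul_assoc, zero_mul, mul_assoc] at h3'
    rw [bracket_skew hX hY, mul_comm y x]
    simp only [map_neg, map_smul, neg_mul, smul_mul_assoc, mul_add, mul_neg, neg_add_rev, neg_neg,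
      smul_add, smul_neg, smul_smul, hss, one_smul]
    rw [eq_neg_of_add_eq_zero_left h3']
    abel

/-- The algebra of chains acting on triples; see `step`. -/
def stepAlg (n : ℕ) :
    Chains n →ₐ[ℝ] Module.End ℝ (Chains n × (PolyMV n →ₗ[ℝ] Chains n) × Chains n) :=
  RingQuot.liftAlgHom ℝ ⟨TensorAlgebra.lift ℝ (step n), by
    rintro _ _ ⟨x, y, X, Y, hX, hY⟩
    simpa using step_swap hX hY⟩

/-- The left action `act n u A = A · u` of a multivector field on a chain: `A · 1 = 0` and
`A · (B △ u) = [A, B] △ u + (-1)^{ab} B △ (A · u)`, see `act_one` and `act_single_mul`. -/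
def act (n : ℕ) : Chains n →ₗ[ℝ] PolyMV n →ₗ[ℝ] Chains n :=
  LinearMap.fst ℝ _ _ ∘ₗ LinearMap.snd ℝ _ _ ∘ₗ
    LinearMap.applyₗ ((1, 0, 0) : Chains n × (PolyMV n →ₗ[ℝ] Chains n) × Chains n) ∘ₗ
    (stepAlg n).toLinearMap

/-- The boundary operator on chains: `∂1 = 0` and
`∂(B △ u) = -B △ ∂u + B · u`, see `boundary_one` and `boundary_single_mul`. -/
def boundary (n : ℕ) : Chains n →ₗ[ℝ] Chains n :=
  LinearMap.snd ℝ _ _ ∘ₗ LinearMap.snd ℝ _ _ ∘ₗ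
    LinearMap.applyₗ ((1, 0, 0) : Chains n × (PolyMV n →ₗ[ℝ] Chains n) × Chains n) ∘ₗ
    (stepAlg n).toLinearMap

theorem stepAlg_single (B : PolyMV n) : stepAlg n (single n B) = step n B := by
  have : stepAlg n (toChains n (TensorAlgebra.ι ℝ B)) = TensorAlgebra.lift ℝ (step n)
      (TensorAlgebra.ι ℝ B) := RingQuot.liftAlgHom_mkAlgHom_apply _ _ _ _
  simpa [single] using this

theorem chains_induction {N : Submodule ℝ (Chains n)} (h1 : 1 ∈ N)
    (hm : ∀ i, ∀ B ∈ grade n i, ∀ u ∈ N, single n B * u ∈ N) (u : Chains n) : u ∈ N := by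
  have hm' : ∀ B : PolyMV n, ∀ u ∈ N, single n B * u ∈ N := by
    intro B u hu
    have : (⊤ : Submodule ℝ (PolyMV n)) ≤ N.comap (LinearMap.mulRight ℝ u ∘ₗ single n) := by
      rw [← iSup_grade]
      exact iSup_le fun i B hB => hm i B hB u hu
    exact this trivial
  obtain ⟨t, rfl⟩ : ∃ t, toChains n t = u := RingQuot.mkAlgHom_surjective ℝ (ChainRel n) u
  suffices h : ∀ u ∈ N, toChains n t * u ∈ N by simpa using h 1 h1
  induction t using TensorAlgebra.induction with
  | algebraMap r =>
    intro u hu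
    rw [AlgHom.commutes, ← Algebra.smul_def]
    exact N.smul_mem r hu
  | ι B => exact hm' B
  | mul a b ha hb => intro u hu; rw [map_mul, mul_assoc]; exact ha _ (hb _ hu)
  | add a b ha hb => intro u hu; rw [map_add, add_mul]; exact add_mem (ha _ hu) (hb _ hu)

theorem stepAlg_fst (u : Chains n) : (stepAlg n u (1, 0, 0)).1 = u := by
  have h : u ∈ LinearMap.eqLocus (LinearMap.fst ℝ _ _ ∘ₗ
      LinearMap.applyₗ ((1, 0, 0) : Chains n × (PolyMV n →ₗ[ℝ] Chains n) × Chains n) ∘ₗ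
      (stepAlg n).toLinearMap) LinearMap.id := by
    refine chains_induction ?_ (fun i B _ u hu => ?_) u
    · simp [LinearMap.mem_eqLocus]
    · simp only [LinearMap.mem_eqLocus, LinearMap.comp_apply, AlgHom.toLinearMap_apply,
        LinearMap.applyₗ_apply_apply, LinearMap.fst_apply, LinearMap.id_apply, map_mul,
        Module.End.mul_apply, stepAlg_single, step_apply] at hu ⊢
      rw [hu]
  exact h

theorem act_one (A : PolyMV n) : act n 1 A = 0 := by simp [act]

theorem boundary_one : boundary n 1 = 0 := by simp [boundary]

theorem act_single_mul {a b : ℕ} {A B : PolyMV n} (hA : A ∈ grade n a) (hB : B ∈ grade n b)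
    (u : Chains n) : act n (single n B * u) A =
      single n (bracket n A B) * u + (-1 : ℝ) ^ (a * b) • (single n B * act n u A) := by
  simp only [act, LinearMap.comp_apply, AlgHom.toLinearMap_apply, LinearMap.applyₗ_apply_apply,
    map_mul, Module.End.mul_apply, stepAlg_single, step_apply, LinearMap.fst_apply,
    LinearMap.snd_apply, LinearMap.add_apply, signSwap_apply hA hB, LinearMap.mulRight_apply,
    LinearMap.flip_apply, stepAlg_fst]

theorem boundary_single_mul (B : PolyMV n) (u : Chains n) :
    boundary n (single n B * u) = -(single n B * boundary n u) + act n u B := by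
  simp only [act, boundary, LinearMap.comp_apply, AlgHom.toLinearMap_apply,
    LinearMap.applyₗ_apply_apply, map_mul, Module.End.mul_apply, stepAlg_single, step_apply,
    LinearMap.fst_apply, LinearMap.snd_apply]

theorem act_act {a b : ℕ} {A B : PolyMV n} (hA : A ∈ grade n a) (hB : B ∈ grade n b)
    (u : Chains n) : act n (act n u B) A =
      act n u (bracket n A B) + (-1 : ℝ) ^ (a * b) • act n (act n u A) B := by
  have h : u ∈ LinearMap.eqLocus ((act n).flip A ∘ₗ (act n).flip B)
      ((act n).flip (bracket n A B)
        + (-1 : ℝ) ^ (a * b) • ((act n).flip B ∘ₗ (act n).flip A)) := by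
    refine chains_induction ?_ (fun c C hC u hu => ?_) u
    · simp [LinearMap.mem_eqLocus, act_one]
    · simp only [LinearMap.mem_eqLocus, LinearMap.comp_apply, LinearMap.flip_apply,
        LinearMap.add_apply, LinearMap.smul_apply] at hu ⊢
      have hAB := bracket_mem_grade hA hB
      have hAC := bracket_mem_grade hA hC
      have hBC := bracket_mem_grade hB hC
      have hss : (-1 : ℝ) ^ (a * b) * (-1 : ℝ) ^ (a * b) = 1 := by
        rw [← pow_add, ← two_mul, pow_mul]; simp
      rw [act_single_mul hB hC, act_single_mul hAB hC, act_single_mul hA hC]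
      simp only [map_add, map_smul, LinearMap.add_apply, LinearMap.smul_apply]
      rw [act_single_mul hA hBC, act_single_mul hA hC, act_single_mul hB hAC,
        act_single_mul hB hC, hu, bracket_jacobi hA hB]
      simp only [map_add, map_smul, add_mul, smul_mul_assoc, mul_add, mul_smul_comm, smul_add,
        pow_add, mul_comm b a]
      linear_combination (norm := module)
        -((-1 : ℝ) ^ (b * c) • hss • (single n (bracket n A C) * act n u B))
  exact h

theorem boundary_act {a : ℕ} {A : PolyMV n} (hA : A ∈ grade n a) (u : Chains n) :
    boundary n (act n u A) = act n (boundary n u) A := by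
  have h : u ∈ LinearMap.eqLocus (boundary n ∘ₗ (act n).flip A)
      ((act n).flip A ∘ₗ boundary n) := by
    refine chains_induction ?_ (fun b B hB u hu => ?_) u
    · simp [LinearMap.mem_eqLocus, act_one, boundary_one]
    · simp only [LinearMap.mem_eqLocus, LinearMap.comp_apply, LinearMap.flip_apply] at hu ⊢
      rw [act_single_mul hA hB, boundary_single_mul]
      simp only [map_add, map_smul, map_neg, LinearMap.add_apply, LinearMap.neg_apply]
      rw [act_single_mul hA hB, boundary_single_mul, boundary_single_mul, hu, act_act hA hB]
      module
  exact h

theorem boundary_boundary (u : Chains n) : boundary n (boundary n u) = 0 := by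
  have h : u ∈ LinearMap.ker (boundary n ∘ₗ boundary n) := by
    refine chains_induction ?_ (fun b B hB u hu => ?_) u
    · simp [boundary_one]
    · simp only [LinearMap.mem_ker, LinearMap.comp_apply] at hu ⊢
      rw [boundary_single_mul, map_add, map_neg, boundary_single_mul, hu, boundary_act hB]
      simp
  exact h

/-- `IsMonomial n m w h u`: the chain `u` is a product `X₁ △ ⋯ △ Xₘ` of bihomogeneous multivector
fields whose double weights add up to `(w, h)`. -/
inductive IsMonomial (n : ℕ) : ℕ → ℤ → ℤ → Chains n → Prop
  | one : IsMonomial n 0 0 0 1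
  | cons (i q m : ℕ) (w h : ℤ) (X : PolyMV n) (u : Chains n) (hX : X ∈ bigrade n i q)
    (hu : IsMonomial n m w h u) :
    IsMonomial n (m + 1) ((i : ℤ) + w) (((q : ℤ) - 1) + h) (single n X * u)

/-- The space of `m`-chains of double weight `(w, h)`. -/
def chainSpace (n m : ℕ) (w h : ℤ) : Submodule ℝ (Chains n) :=
  Submodule.span ℝ {u | IsMonomial n m w h u}

theorem single_mul_mem {i q m : ℕ} {w h w' h' : ℤ} {X : PolyMV n} {u : Chains n}
    (hX : X ∈ bigrade n i q) (hu : u ∈ chainSpace n m w h) (hw : w' = i + w)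
    (hh : h' = (q - 1) + h) : single n X * u ∈ chainSpace n (m + 1) w' h' := by
  subst hw hh
  have : chainSpace n m w h ≤ (chainSpace n (m + 1) (i + w) ((q - 1) + h)).comap
      (LinearMap.mulLeft ℝ (single n X)) :=
    Submodule.span_le.2 fun u hu => Submodule.subset_span (IsMonomial.cons i q m w h X u hX hu)
  exact this hu

theorem act_mem_of_isMonomial {i q m : ℕ} {w h : ℤ} {A : PolyMV n} {u : Chains n}
    (hA : A ∈ bigrade n i q) (hu : IsMonomial n m w h u) :
    act n u A ∈ chainSpace n m (i + w) ((q - 1) + h) := by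
  induction hu with
  | one => rw [act_one]; exact zero_mem _
  | cons j r m w h B u hB hu ih =>
    rw [act_single_mul (bigrade_le _ _ _ hA) (bigrade_le _ _ _ hB)]
    refine add_mem ?_ (Submodule.smul_mem _ _ ?_)
    · rcases bracket_mem_bigrade hA hB with h0 | ⟨s, hs, hm⟩
      · rw [h0, map_zero, zero_mul]; exact zero_mem _
      · refine single_mul_mem hm (Submodule.subset_span hu) ?_ ?_
        · push_cast; ring
        · have : (q : ℤ) + r = s + 1 := by exact_mod_cast hs
          linarith
    · exact single_mul_mem hB ih (by ring) (by ring)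

theorem boundary_mem {m : ℕ} {w h : ℤ} {u : Chains n} (hu : u ∈ chainSpace n (m + 1) w h) :
    boundary n u ∈ chainSpace n m w h := by
  have key : ∀ (m' : ℕ) (w h : ℤ) (u : Chains n), IsMonomial n m' w h u →
      ∀ m, m' = m + 1 → boundary n u ∈ chainSpace n m w h := by
    intro m' w h u hu
    induction hu with
    | one => intro m hm; omega
    | cons i q m w h B u hB hu ih =>
      rintro m' hm
      obtain rfl : m = m' := by omega
      rw [boundary_single_mul]
      refine add_mem (neg_mem ?_) (act_mem_of_isMonomial hB hu)
      cases hu with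
      | one => rw [boundary_one, mul_zero]; exact zero_mem _
      | cons j r m w h C u hC hu => exact single_mul_mem hB (ih m rfl) rfl rfl
  have : chainSpace n (m + 1) w h ≤ (chainSpace n m w h).comap (boundary n) :=
    Submodule.span_le.2 fun u hu => key _ _ _ _ hu m rfl
  exact this hu

/-- The boundary operator on chains of double weight `(w, h)`. -/
def chainBoundary (n m : ℕ) (w h : ℤ) : chainSpace n (m + 1) w h →ₗ[ℝ] chainSpace n m w h :=
  (boundary n).restrict fun _ hu => boundary_mem hu

/-- The chain complex of double weight `(w, h)`. -/
def chainComplex (n : ℕ) (w h : ℤ) : ChainComplex (ModuleCat ℝ) ℕ :=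
  ChainComplex.of (fun m => ModuleCat.of ℝ (chainSpace n m w h))
    (fun m => ModuleCat.ofHom (chainBoundary n m w h)) fun m => by
      refine ModuleCat.hom_ext (LinearMap.ext fun u => Subtype.ext ?_)
      exact boundary_boundary (n := n) u

/-- The homology groups of double weight `(w, h)`. -/
abbrev homology (n m : ℕ) (w h : ℤ) : ModuleCat ℝ := (chainComplex n w h).homology m

/-- The Betti numbers of double weight `(w, h)`: the dimensions of the homology groups. -/
def bettiNumber (n m : ℕ) (w h : ℤ) : Cardinal := Module.rank ℝ (homology n m w h)

end Multivector

end

namespace Multivector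

variable {n : ℕ}

/-! The proof rests on two facts about a coordinate field `∂_k`: its bracket differentiates
coefficients along `x_k`, and this operator is surjective on polynomial multivector fields. Write `X
= [∂_k, X']`. As `∂_k` has degree 0, the boundary of `∂_k △ X' △ Y` is `X △ Y + X' △ [∂_k, Y] - ∂_k
△ [X', Y]`. Modulo boundaries, `X △ Y` is thus traded for `-X' △ [∂_k, Y]` plus a term `∂_k △
(...)`. The coefficient degree of the second factor drops each time, so the process stops, and every
2-chain is congruent to some `∂_k △ Z` (`exists_sub_coordField_mul_mem`).

If the 2-chain is a cycle, applying the boundary to this congruence gives `[∂_k, Z] = 0`, because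
1-chains are faithful copies of multivector fields (`single_injective`).

It remains to bound such a `∂_k △ Z` (`coordField_mul_mem_boundaries`). Let `r` be the degree of the
coefficients of `Z`. Summing the boundaries of `∂_k △ ∂_l △ x_l Z` over all `l` gives, by Euler's
identity, `(1 - n - r) ∂_k △ Z`. The scalar is nonzero when `n ≥ 1` and `r > 0`. In double weight
`(w, w)` with `w ≥ 0` one has `r = w + 2`; for `w < 0` or `n = 0` there are no nonzero 2-chains. -/

/-! ### Polynomial antiderivatives in one variable. -/

theorem exists_isHomogeneous_pderiv_eq (k : Fin n) {q : ℕ} {f : MvPolynomial (Fin n) ℝ}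
    (hf : f.IsHomogeneous q) :
    ∃ g : MvPolynomial (Fin n) ℝ, g.IsHomogeneous (q + 1) ∧ MvPolynomial.pderiv k g = f := by
  -- The termwise antiderivative in `x_k`, without integration constant: each exponent of `x_k`
  -- rises by one and the coefficient is divided by the new exponent.
  refine ⟨∑ β ∈ f.support, MvPolynomial.monomial (β + Finsupp.single k 1)
    (f.coeff β / (β k + 1)), ?_, ?_⟩
  · refine MvPolynomial.IsHomogeneous.sum _ _ _ fun β hβ => ?_
    refine MvPolynomial.isHomogeneous_monomial _ ?_
    rw [map_add, Finsupp.degree_single,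
      Finsupp.degree_eq_weight_one]
    exact congrArg (· + 1) (hf (MvPolynomial.mem_support_iff.1 hβ))
  · rw [map_sum]
    conv_rhs => rw [f.as_sum]
    refine Finset.sum_congr rfl fun β _ => ?_
    have : (β k : ℝ) + 1 ≠ 0 := by positivity
    rw [MvPolynomial.pderiv_monomial, add_tsub_cancel_right]
    congr 1
    simp
    field_simp

theorem exists_diffX_eq (k : Fin n) {p q : ℕ} {X : MV n} (hX : X ∈ mvBideg n p q) :
    ∃ Y ∈ mvBideg n p (q + 1), diffX k Y = X := by
  have : mvBideg n p q ≤ (mvBideg n p (q + 1)).map (diffX k) := by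
    refine Submodule.map₂_le.2 fun f hf S hS => ?_
    obtain ⟨g, hg, rfl⟩ := exists_isHomogeneous_pderiv_eq k hf
    exact ⟨mk n g S, Submodule.apply_mem_map₂ _ hg hS, rfl⟩
  exact this hX

/-! ### Coordinate fields and their brackets. -/

/-- The coordinate vector field `∂_k`. -/
noncomputable def coordField (k : Fin n) : PolyMV n :=
  ⟨mk n 1 (ExteriorAlgebra.ι ℝ (Pi.single k 1)), mvDeg_le_posDeg n 0 <|
    Submodule.apply_mem_map₂ _ trivial (by simp [ExteriorAlgebra.exteriorPower])⟩

theorem coordField_mem_bigrade (k : Fin n) : coordField k ∈ bigrade n 0 0 :=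
  Submodule.apply_mem_map₂ (mk n) (MvPolynomial.isHomogeneous_one (Fin n) ℝ)
    (by simp [ExteriorAlgebra.exteriorPower])

theorem coordField_mem_grade (k : Fin n) : coordField k ∈ grade n 0 :=
  bigrade_le n 0 0 (coordField_mem_bigrade k)

theorem one_mul_mk (Y : MV n) : mk n 1 1 * Y = Y := one_mul Y

theorem schouten_coordField (k : Fin n) (Y : MV n) :
    schouten n (coordField k : MV n) Y = diffX k Y := by
  -- The coefficient 1 is constant, which kills the terms differentiating `∂_k`; contracting `∂_k`
  -- with `dx_l` leaves only `l = k`.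
  rw [schouten_apply, Finset.sum_eq_single k]
  · simp [coordField, one_mul_mk]
  · intro l _ hl
    simp [coordField, hl]
  · simp

theorem coe_bracket_coordField (k : Fin n) (Y : PolyMV n) :
    (bracket n (coordField k) Y : MV n) = diffX k (Y : MV n) :=
  schouten_coordField k Y

theorem bracket_coordField_coordField (k l : Fin n) :
    bracket n (coordField k) (coordField l) = 0 :=
  Subtype.ext <| (coe_bracket_coordField k _).trans <|
    diffX_eq_zero k (coordField_mem_bigrade l)

/-- Surjectivity of the bracket with `∂_k`, with control of the bidegree: this supplies the `X'` in
the reduction of 2-chains. -/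
theorem exists_bracket_coordField_eq (k : Fin n) {i q : ℕ} {X : PolyMV n}
    (hX : X ∈ bigrade n i q) :
    ∃ Y ∈ bigrade n i (q + 1), bracket n (coordField k) Y = X := by
  obtain ⟨Y, hY, h⟩ := exists_diffX_eq k (show (X : MV n) ∈ mvBideg n (i + 1) q from hX)
  exact ⟨⟨Y, mvDeg_le_posDeg n i (mvBideg_le _ _ _ hY)⟩, hY,
    Subtype.ext ((coe_bracket_coordField k _).trans h)⟩

/-! ### Multiplication by coordinates and Euler's identity. -/

/-- Multiplication of the coefficients by `x_k`. -/
noncomputable def mulX (k : Fin n) : PolyMV n →ₗ[ℝ] PolyMV n :=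
  (LinearMap.mulLeft ℝ (mk n (MvPolynomial.X k) 1)).restrict fun X hX => by
    have : posDeg n ≤ (posDeg n).comap (LinearMap.mulLeft ℝ (mk n (MvPolynomial.X k) 1)) := by
      refine posDeg_le fun i => Submodule.map₂_le.2 fun f _ S hS => ?_
      rw [Submodule.mem_comap, LinearMap.mulLeft_apply, mk_mul_mk, one_mul]
      exact mvDeg_le_posDeg n i (Submodule.apply_mem_map₂ _ trivial hS)
    exact this hX

theorem coe_mulX (k : Fin n) (X : PolyMV n) :
    (mulX k X : MV n) = mk n (MvPolynomial.X k) 1 * (X : MV n) := rfl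

theorem mulX_mem_bigrade (k : Fin n) {i q : ℕ} {X : PolyMV n} (hX : X ∈ bigrade n i q) :
    mulX k X ∈ bigrade n i (q + 1) := by
  have h : mk n (MvPolynomial.X k) 1 ∈ mvBideg n 0 1 :=
    Submodule.apply_mem_map₂ (mk n) (MvPolynomial.isHomogeneous_X ℝ k)
      (by simp [ExteriorAlgebra.exteriorPower])
  have := mul_mem_mvBideg h (show (X : MV n) ∈ mvBideg n (i + 1) q from hX)
  rwa [zero_add, add_comm 1 q] at this

/-- The Leibniz rule with `∂x_l/∂x_k = δ_{kl}`, i.e. the Weyl algebra relation. -/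
theorem bracket_coordField_mulX (k l : Fin n) (X : PolyMV n) :
    bracket n (coordField k) (mulX l X) =
      (if k = l then X else 0) + mulX l (bracket n (coordField k) X) := by
  apply Subtype.ext
  rw [coe_bracket_coordField, coe_mulX, diffX_mul, Submodule.coe_add, coe_mulX,
    coe_bracket_coordField, diffX_mk, MvPolynomial.pderiv_X]
  by_cases h : k = l
  · subst h
    simp [one_mul_mk]
  · simp [h, Ne.symm h]

/-- Euler's identity for multivector fields with homogeneous coefficients. -/
theorem sum_mulX_bracket_coordField {i q : ℕ} {X : PolyMV n} (hX : X ∈ bigrade n i q) :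
    ∑ k, mulX k (bracket n (coordField k) X) = (q : ℝ) • X := by
  have h : mvBideg n (i + 1) q ≤ LinearMap.eqLocus
      (∑ k : Fin n, LinearMap.mulLeft ℝ (mk n (MvPolynomial.X k) 1) ∘ₗ diffX k)
      ((q : ℝ) • LinearMap.id) := by
    refine Submodule.map₂_le.2 fun f hf S hS => ?_
    have hE := MvPolynomial.IsHomogeneous.sum_X_mul_pderiv (show f.IsHomogeneous q from hf)
    simp only [LinearMap.mem_eqLocus, LinearMap.sum_apply, LinearMap.comp_apply, diffX_mk,
      LinearMap.mulLeft_apply, mk_mul_mk, one_mul, LinearMap.smul_apply, LinearMap.id_apply]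
    rw [← LinearMap.sum_apply, ← map_sum, hE, map_nsmul, LinearMap.smul_apply,
      Nat.cast_smul_eq_nsmul]
  have := h (show (X : MV n) ∈ mvBideg n (i + 1) q from hX)
  apply Subtype.ext
  rw [LinearMap.mem_eqLocus, LinearMap.sum_apply] at this
  simpa [coe_mulX, coe_bracket_coordField] using this

/-! ### Chains of length one to three and their boundaries. -/

/-- The relations are quadratic, so they hold in the algebra `ℝ ⊕ PolyMV n` where any two
multivector fields multiply to zero; the induced map recovers `X` from `single n X`. -/
theorem single_injective : Function.Injective (single n) := by
  -- The algebra structure on `TrivSqZeroExt` asks for a right action too; it is taken equal to the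
  -- left one.
  let _ : Module ℝᵐᵒᵖ (PolyMV n) := Module.compHom _ ((RingHom.id ℝ).fromOpposite mul_comm)
  have : IsCentralScalar ℝ (PolyMV n) := ⟨fun _ _ => rfl⟩
  let φ : Chains n →ₐ[ℝ] TrivSqZeroExt ℝ (PolyMV n) :=
    RingQuot.liftAlgHom ℝ ⟨TensorAlgebra.lift ℝ (TrivSqZeroExt.inrHom ℝ (PolyMV n)), by
      rintro _ _ ⟨x, y, X, Y, hX, hY⟩
      simp⟩
  have hφ : ∀ X, φ (single n X) = TrivSqZeroExt.inr X := fun X => by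
    have : φ (toChains n (TensorAlgebra.ι ℝ X)) = TensorAlgebra.lift ℝ
      (TrivSqZeroExt.inrHom ℝ (PolyMV n)) (TensorAlgebra.ι ℝ X) :=
        RingQuot.liftAlgHom_mkAlgHom_apply _ _ _ _
    simpa [single] using this
  intro X Y h
  exact TrivSqZeroExt.inr_injective (by rw [← hφ, ← hφ, h])

theorem boundary_single (A : PolyMV n) : boundary n (single n A) = 0 := by
  have := boundary_single_mul A 1
  simpa [boundary_one, act_one] using this

theorem act_single {a b : ℕ} {A B : PolyMV n} (hA : A ∈ grade n a) (hB : B ∈ grade n b) :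
    act n (single n B) A = single n (bracket n A B) := by
  have := act_single_mul hA hB 1
  simpa [act_one] using this

theorem boundary_single_mul_single {a b : ℕ} {A B : PolyMV n} (hA : A ∈ grade n a)
    (hB : B ∈ grade n b) :
    boundary n (single n A * single n B) = single n (bracket n A B) := by
  rw [boundary_single_mul, boundary_single, act_single hA hB, mul_zero, neg_zero, zero_add]

/-- `∂_k` has degree 0, so it acts on `B △ C` as a derivation without signs. Modulo boundaries and
terms `∂_k △ (...)`, this is integration by parts along `x_k`. -/
theorem boundary_coordField_mul {b c : ℕ} (k : Fin n) {B C : PolyMV n} (hB : B ∈ grade n b)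
    (hC : C ∈ grade n c) :
    boundary n (single n (coordField k) * (single n B * single n C)) =
      -(single n (coordField k) * single n (bracket n B C))
        + (single n (bracket n (coordField k) B) * single n C
          + single n B * single n (bracket n (coordField k) C)) := by
  rw [boundary_single_mul, boundary_single_mul_single hB hC,
    act_single_mul (coordField_mem_grade k) hB, act_single (coordField_mem_grade k) hC,
    zero_mul, pow_zero, one_smul]

theorem single_mem_chainSpace {i q : ℕ} {X : PolyMV n} (hX : X ∈ bigrade n i q) :
    single n X ∈ chainSpace n 1 i (q - 1) := by
  have h : (1 : Chains n) ∈ chainSpace n 0 0 0 := Submodule.subset_span IsMonomial.one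
  simpa using single_mul_mem hX h rfl rfl

/-- The boundaries of `(m + 1)`-chains of double weight `(w, h)`. -/
noncomputable abbrev boundaries (n m : ℕ) (w h : ℤ) : Submodule ℝ (Chains n) :=
  (chainSpace n (m + 1) w h).map (boundary n)

theorem boundary_coordField_mul_mem {b c p q : ℕ} {w h : ℤ} (k : Fin n) {B C : PolyMV n}
    (hB : B ∈ bigrade n b p) (hC : C ∈ bigrade n c q) (hw : w = b + c) (hh : h = p + q - 3) :
    boundary n (single n (coordField k) * (single n B * single n C)) ∈ boundaries n 2 w h :=
  Submodule.mem_map_of_mem <| single_mul_mem (coordField_mem_bigrade k)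
    (single_mul_mem hB (single_mem_chainSpace hC) rfl rfl) (by rw [hw]; simp)
    (by rw [hh]; push_cast; ring)

/-! ### The normal form `∂_k △ Z` of a 2-chain. -/

/-- Modulo boundaries every product of two multivector fields is of the form `∂_k △ Z`. -/
theorem exists_sub_coordField_mul_mem (k : Fin n) {a b p q : ℕ} {X Y : PolyMV n}
    (hX : X ∈ bigrade n a p) (hY : Y ∈ bigrade n b q) :
    ∃ Z ∈ bigrade n (a + b) (p + q),
      single n X * single n Y - single n (coordField k) * single n Z
        ∈ boundaries n 2 (a + b : ℕ) ((p + q : ℕ) - 2) := by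
  induction q generalizing p X Y with
  | zero =>
    obtain ⟨X', hX', rfl⟩ := exists_bracket_coordField_eq k hX
    -- Passing to `X'` raises the coefficient degree by one and the bracket lowers it by one, so the
    -- total is unchanged.
    have hZ : bracket n X' Y ∈ bigrade n (a + b) (p + 0) := by
      rcases bracket_mem_bigrade hX' hY with h | ⟨r, hr, h⟩
      · rw [h]; exact zero_mem _
      · rwa [show p + 0 = r by omega]
    refine ⟨_, hZ, ?_⟩
    -- The coefficients of `Y` are constants, so the term `X' △ [∂_k, Y]` is absent.
    have hY0 : bracket n (coordField k) Y = 0 :=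
      Subtype.ext ((coe_bracket_coordField k Y).trans (diffX_eq_zero k hY))
    have := boundary_coordField_mul_mem (w := (a + b : ℕ)) (h := (p + 0 : ℕ) - 2) k hX' hY
      (by push_cast; ring) (by push_cast; ring)
    rw [boundary_coordField_mul k (bigrade_le _ _ _ hX') (bigrade_le _ _ _ hY), hY0, map_zero,
      mul_zero, add_zero (single n _ * _)] at this
    rwa [neg_add_eq_sub] at this
  | succ q ih =>
    obtain ⟨X', hX', rfl⟩ := exists_bracket_coordField_eq k hX
    have hZ : bracket n X' Y ∈ bigrade n (a + b) (p + (q + 1)) := by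
      rcases bracket_mem_bigrade hX' hY with h | ⟨r, hr, h⟩
      · rw [h]; exact zero_mem _
      · rwa [show p + (q + 1) = r by omega]
    have hY' : bracket n (coordField k) Y ∈ bigrade n b q := by
      change (bracket n (coordField k) Y : MV n) ∈ mvBideg n (b + 1) q
      rw [coe_bracket_coordField]
      exact diffX_mem_mvBideg k hY
    -- The leftover product `X' △ [∂_k, Y]` has coefficient degrees `p + 1` and `q`; this is why the
    -- induction runs over all `p`, `X` and `Y`.
    obtain ⟨Z', hZ', h'⟩ := ih hX' hY'
    rw [show p + 1 + q = p + (q + 1) by ring] at hZ' h'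
    refine ⟨bracket n X' Y - Z', sub_mem hZ hZ', ?_⟩
    have := boundary_coordField_mul_mem (w := (a + b : ℕ)) (h := (p + (q + 1) : ℕ) - 2) k hX' hY
      (by push_cast; ring) (by push_cast; ring)
    rw [boundary_coordField_mul k (bigrade_le _ _ _ hX') (bigrade_le _ _ _ hY)] at this
    have h := sub_mem this h'
    convert h using 1
    rw [map_sub, mul_sub]
    abel

theorem exists_sub_coordField_mul_mem_of_mem_chainSpace (k : Fin n) {i r : ℕ} {u : Chains n}
    (hu : u ∈ chainSpace n 2 i ((r : ℤ) - 2)) :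
    ∃ Z ∈ bigrade n i r,
      u - single n (coordField k) * single n Z ∈ boundaries n 2 i ((r : ℤ) - 2) := by
  induction hu using Submodule.span_induction with
  | mem u hu =>
    -- With variable indices the monomial can be taken apart one factor at a time; only length two
    -- survives.
    generalize hm : 2 = m at hu
    generalize hw : (i : ℤ) = w at hu
    generalize hh : (r : ℤ) - 2 = h at hu
    rcases hu with _ | ⟨a, p, m, w, h, X, u, hX, hu⟩
    · omega
    rcases hu with _ | ⟨b, q, m, w, h, Y, u, hY, hu⟩
    · omega
    rcases hu with _ | ⟨c, s, m, w, h, Z, u, hZ, hu⟩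
    · obtain rfl : i = a + b := by omega
      obtain rfl : r = p + q := by omega
      rw [← hw, ← hh, mul_one]
      exact exists_sub_coordField_mul_mem k hX hY
    · omega
  | zero => exact ⟨0, zero_mem _, by simp⟩
  | add u v _ _ hu hv =>
    obtain ⟨Y, hY, h⟩ := hu
    obtain ⟨Z, hZ, h'⟩ := hv
    refine ⟨Y + Z, add_mem hY hZ, ?_⟩
    convert add_mem h h' using 1
    rw [map_add, mul_add]
    abel
  | smul c u _ hu =>
    obtain ⟨Z, hZ, h⟩ := hu
    refine ⟨c • Z, Submodule.smul_mem _ _ hZ, ?_⟩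
    convert Submodule.smul_mem _ c h using 1
    rw [map_smul, mul_smul_comm, smul_sub]

/-! ### Bounding the cycles in normal form. -/

/-- If the coefficients of `Z` do not depend on `x_k`, the cycle `∂_k △ Z` is a boundary. -/
theorem coordField_mul_mem_boundaries (k : Fin n) {i r : ℕ} (hr : r ≠ 0) {Z : PolyMV n}
    (hZ : Z ∈ bigrade n i r) (h0 : bracket n (coordField k) Z = 0) :
    single n (coordField k) * single n Z ∈ boundaries n 2 i ((r : ℤ) - 2) := by
  -- For `l ≠ k`, independence of `x_k` makes `[∂_k, x_l Z]` vanish, so only `-∂_k △ [∂_l, x_l Z]`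
  -- remains. For `l = k` that term is cancelled by `∂_k △ [∂_k, x_k Z]`.
  have hb : ∀ l, boundary n (single n (coordField k) *
      (single n (coordField l) * single n (mulX l Z))) =
      single n (coordField k) * single n ((if k = l then Z else 0) - Z
        - mulX l (bracket n (coordField l) Z)) := fun l => by
    rw [boundary_coordField_mul k (coordField_mem_grade l)
      (bigrade_le _ _ _ (mulX_mem_bigrade l hZ)), bracket_coordField_coordField, map_zero, zero_mul,
      bracket_coordField_mulX, bracket_coordField_mulX, if_pos rfl, h0, map_zero, add_zero]
    by_cases h : k = l
    · subst h
      simp only [if_true, map_add, map_sub, mul_add, mul_sub]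
      abel
    · simp only [if_neg h, map_add, map_sub, map_zero, mul_add, mul_sub, mul_zero]
      abel
  have hmem := sum_mem (t := Finset.univ) fun l (_ : l ∈ Finset.univ) =>
    boundary_coordField_mul_mem (w := i) (h := (r : ℤ) - 2) k (coordField_mem_bigrade l)
      (mulX_mem_bigrade l hZ) (by simp) (by push_cast; ring)
  -- The three summands contribute `1`, `-n` and, by Euler's identity, `-r`.
  have hsum : ∑ l, ((if k = l then Z else 0) - Z - mulX l (bracket n (coordField l) Z)) =
      (1 - n - r : ℝ) • Z := by
    rw [Finset.sum_sub_distrib, Finset.sum_sub_distrib, sum_mulX_bracket_coordField hZ]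
    simp only [Finset.sum_ite_eq, Finset.mem_univ, if_true, Finset.sum_const, Finset.card_univ,
      Fintype.card_fin, ← Nat.cast_smul_eq_nsmul ℝ]
    module
  simp only [hb] at hmem
  rw [← Finset.mul_sum, ← map_sum, hsum, map_smul, mul_smul_comm] at hmem
  -- The existence of `k` forces `n ≥ 1`, so `1 - n - r ≤ -r < 0`.
  refine (Submodule.smul_mem_iff _ ?_).1 hmem
  have h1 : (1 : ℝ) ≤ n := by exact_mod_cast k.pos
  have h2 : (0 : ℝ) < r := by positivity
  linarith

/-! ### Degenerate cases: dimension zero and negative weight. -/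

theorem bigrade_zero_eq_bot (i q : ℕ) : bigrade 0 i q = ⊥ := by
  have hι : (ExteriorAlgebra.ι ℝ : (Fin 0 → ℝ) →ₗ[ℝ] _) = 0 :=
    LinearMap.ext fun v => by rw [Subsingleton.elim v 0]; simp
  have h : mvBideg 0 (i + 1) q = ⊥ := by
    rw [mvBideg, ExteriorAlgebra.exteriorPower, hι, LinearMap.range_zero, ← Submodule.zero_eq_bot,
      zero_pow (Nat.succ_ne_zero i), Submodule.zero_eq_bot, Submodule.map₂_bot_right]
  rw [bigrade, h, Submodule.comap_bot, Submodule.ker_subtype]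

theorem chainSpace_zero_succ (m : ℕ) (w h : ℤ) : chainSpace 0 (m + 1) w h = ⊥ := by
  refine Submodule.span_eq_bot.2 fun u hu => ?_
  rcases hu with _ | ⟨a, p, m, w, h, X, u, hX, hu⟩
  rw [bigrade_zero_eq_bot, Submodule.mem_bot] at hX
  rw [hX, map_zero, zero_mul]

theorem IsMonomial.weight_nonneg {m : ℕ} {w h : ℤ} {u : Chains n} (hu : IsMonomial n m w h u) :
    0 ≤ w := by
  induction hu with
  | one => rfl
  | cons i q m w h X u hX hu ih => omega

theorem chainSpace_of_neg {w : ℤ} (hw : w < 0) (m : ℕ) (h : ℤ) : chainSpace n m w h = ⊥ :=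
  Submodule.span_eq_bot.2 fun _ hu => absurd hu.weight_nonneg (not_le.2 hw)

/-! ### Vanishing of the second homology. -/

/-- Every 2-cycle of double weight `(w, w)` is the boundary of a 3-chain of the same weight. -/
theorem mem_boundaries_of_boundary_eq_zero {w : ℤ} {u : Chains n} (hu : u ∈ chainSpace n 2 w w)
    (h0 : boundary n u = 0) : u ∈ boundaries n 2 w w := by
  rcases lt_or_ge w 0 with hw | hw
  · rw [chainSpace_of_neg hw, Submodule.mem_bot] at hu
    rw [hu]
    exact zero_mem _
  lift w to ℕ using hw
  rcases n with _ | n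
  · rw [chainSpace_zero_succ, Submodule.mem_bot] at hu
    rw [hu]
    exact zero_mem _
  -- Each of the two factors has second weight one less than its coefficient degree, so the total
  -- coefficient degree is `w + 2`, in particular positive.
  have hr : (w : ℤ) = ((w + 2 : ℕ) : ℤ) - 2 := by push_cast; ring
  obtain ⟨Z, hZ, h⟩ := exists_sub_coordField_mul_mem_of_mem_chainSpace (0 : Fin (n + 1))
    (i := w) (r := w + 2) (by rwa [← hr])
  -- The boundary kills `u` and every boundary, hence also `∂_0 △ Z`, whose boundary is the 1-chain
  -- `[∂_0, Z]`.
  have hZ0 : bracket (n + 1) (coordField 0) Z = 0 := by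
    obtain ⟨v, -, hv⟩ := h
    apply single_injective
    have := congrArg (boundary (n + 1)) hv
    rw [boundary_boundary, map_sub, h0, boundary_single_mul_single (coordField_mem_grade 0)
      (bigrade_le _ _ _ hZ), zero_sub] at this
    rw [map_zero, ← neg_eq_zero, ← this]
  have := add_mem h (coordField_mul_mem_boundaries 0 (by omega) hZ hZ0)
  rwa [sub_add_cancel, ← hr] at this

end Multivector

theorem mainTheorem1 (n : ℕ) (w : ℤ) : Multivector.bettiNumber n 2 w w = 0 := by
  have hex : (Multivector.chainComplex n w w).ExactAt 2 := by
    rw [HomologicalComplex.exactAt_iff' _ 3 2 1 (by simp) (by simp),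
      CategoryTheory.ShortComplex.moduleCat_exact_iff]
    intro u hu
    have d1 : (Multivector.chainComplex n w w).d 2 1 =
      ModuleCat.ofHom (Multivector.chainBoundary n 1 w w) :=
        ChainComplex.of_d (fun m => ModuleCat.of ℝ (Multivector.chainSpace n m w w))
          (fun m => ModuleCat.ofHom (Multivector.chainBoundary n m w w)) 1
    have d2 : (Multivector.chainComplex n w w).d 3 2 =
      ModuleCat.ofHom (Multivector.chainBoundary n 2 w w) :=
        ChainComplex.of_d (fun m => ModuleCat.of ℝ (Multivector.chainSpace n m w w))
          (fun m => ModuleCat.ofHom (Multivector.chainBoundary n m w w)) 2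
    have hu' : Multivector.chainBoundary n 1 w w u = 0 := by
      change ((Multivector.chainComplex n w w).d 2 1).hom u = 0 at hu
      rwa [d1] at hu
    obtain ⟨v, hv, h⟩ := Multivector.mem_boundaries_of_boundary_eq_zero u.2
      (congrArg Subtype.val hu')
    refine ⟨(⟨v, hv⟩ : Multivector.chainSpace n 3 w w), ?_⟩
    change ((Multivector.chainComplex n w w).d 3 2).hom _ = u
    rw [d2]
    exact Subtype.ext h
  have hz := hex.isZero_homology
  have := ModuleCat.subsingleton_of_isZero hz
  exact rank_subsingleton' ℝ (Multivector.homology n 2 w w)
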